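/- Let $f$ be holomorphic on the open unit disc and at the point $1$, with $f(0)=0$, with Taylor coefficients $f^{(n)}(0)/n!$ of at most polynomial growth in $n$, and with $f'(1)+f''(1)\neq 0$ (for instance $f(x)=x$). Put $c_n=\sum_{d\mid n}\frac{f^{(d)}(0)}{d!}\,d\,\mu(n/d)$, where $\mu$ is the Möbius function. Say that $W$ is the regularized product $\prod_p p^{\log p}$ over all primes obtained through $f$ if $W=e^{V}$ for some $V\in\mathbb C$ (the regularized value of $\sum_p(\log p)^2$) for which the following two conditions hold. (a) For $\operatorname{Re}s>1$ the sum $\sum_p f(p^{-s})$ converges absolutely and is holomorphic in $s$, and its second derivative is given by the absolutely convergent expansions $$\frac{d^2}{ds^2}\sum_p f(p^{-s})=\sum_p\bigl(f''(p^{-s})p^{-2s}+f'(p^{-s})p^{-s}\bigr)(\log p)^2=\sum_{n\ge1} n\,c_n\,(\log\zeta)''(ns),\qquad (\log\zeta)''=\frac{\zeta''\zeta-(\zeta')^2}{\zeta^2}.$$ (b) The terms are evaluated at $s=0$, with the weight $n$ replaced by $n^{-h}$: the series $\sum_{n\ge1}c_n n^{-h}(\log\zeta)''(0)$ converges absolutely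 for $\operatorname{Re}h$ large, its sum has a meromorphic continuation to a half-plane $\operatorname{Re}h>\sigma_0$ with $\sigma_0<-1$, and the limit of this continuation as $h\to-1$ is $(f'(1)+f''(1))\,V$. Then the regularized product obtained through $f$ exists, is unique, and does not depend on $f$: $$\prod_p p^{\log p}=e^{24\,\zeta''(0)+12(\log 2\pi)^2}.$$ -/

import Mathlib

open Filter Topology

noncomputable section

namespace PrimeProduct

/-- The coefficient `∑_{d ∣ n} (f⁽ᵈ⁾(0) / d!) d μ(n / d)` (equal to `0` for `n = 0`);
here `d / d! = 1 / Γ(d)`. -/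
def coeff (f : ℂ → ℂ) (n : ℕ) : ℂ :=
  ∑ d ∈ n.divisors,
    iteratedDeriv d f 0 / (Nat.factorial d : ℂ) * (d : ℂ) *
      ((ArithmeticFunction.moebius (n / d) : ℤ) : ℂ)

/-- The second derivative of `log ζ`, i.e. `(ζ'' ζ - ζ' ^ 2) / ζ ^ 2`. -/
def logZetaSecond (z : ℂ) : ℂ :=
  (iteratedDeriv 2 riemannZeta z * riemannZeta z - deriv riemannZeta z ^ 2) / riemannZeta z ^ 2

/-- The prime sum `∑_p f(p⁻ˢ)`. -/
def primeSum (f : ℂ → ℂ) (s : ℂ) : ℂ :=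
  ∑' p : Nat.Primes, f ((p : ℂ) ^ (-s))

/-- The second `s`-derivative of `f(p⁻ˢ)`. At `s = 0` it is `(f''(1) + f'(1)) (log p)²`. -/
def primeTerm (f : ℂ → ℂ) (s : ℂ) (p : Nat.Primes) : ℂ :=
  (iteratedDeriv 2 f ((p : ℂ) ^ (-s)) * (p : ℂ) ^ (-(2 * s))
    + deriv f ((p : ℂ) ^ (-s)) * (p : ℂ) ^ (-s)) * (-(Real.log (p : ℝ) : ℂ)) ^ 2

/-- The `n`-th term of the zeta expansion of the second derivative of the prime sum, with the
weight `n` replaced by `n⁻ʰ`; the expansion itself is the case `h = -1`. -/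
def zetaTerm (f : ℂ → ℂ) (h s : ℂ) (n : ℕ) : ℂ :=
  coeff f n * (n : ℂ) ^ (-h) * logZetaSecond ((n : ℂ) * s)

/-- `V` is the regularized value of `∑_p (log p)²` obtained through `f`. For `Re s > 1` the second
derivative of `∑_p f(p⁻ˢ)` is the convergent sum of the `primeTerm`s, and is expanded in the
`zetaTerm`s with `h = -1`. At `s = 0` the left side is formally `(f'(1) + f''(1)) ∑_p (log p)²`;
the right side, divergent at `h = -1`, is summed for `Re h` large, continued
meromorphically in `h` to a half-plane containing `-1`, and evaluated by the limit `h → -1`. -/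
structure IsRegularizedLogSqSum (f : ℂ → ℂ) (V : ℂ) : Prop where
  /-- the prime sum converges and may be differentiated twice term by term, and the result
  has the zeta expansion -/
  expansion : ∀ s : ℂ, 1 < s.re →
    Summable (fun p : Nat.Primes => f ((p : ℂ) ^ (-s))) ∧
    AnalyticAt ℂ (primeSum f) s ∧
    HasSum (primeTerm f s) (iteratedDeriv 2 (primeSum f) s) ∧
    HasSum (zetaTerm f (-1) s) (iteratedDeriv 2 (primeSum f) s)
  /-- the value at `s = 0`, regularized by `h → -1` -/
  value : ∃ (Φ : ℂ → ℂ) (σ₀ σ₁ : ℝ), σ₀ < -1 ∧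
    MeromorphicOn Φ {h : ℂ | σ₀ < h.re} ∧
    (∀ h : ℂ, σ₁ < h.re → HasSum (zetaTerm f h 0) (Φ h)) ∧
    Tendsto Φ (𝓝[≠] (-1)) (𝓝 ((deriv f 1 + iteratedDeriv 2 f 1) * V))

/-- `W` is the regularized value of `∏_p p ^ log p = exp (∑_p (log p)²)` obtained through `f`. -/
def IsRegularizedProduct (f : ℂ → ℂ) (W : ℂ) : Prop :=
  ∃ V : ℂ, IsRegularizedLogSqSum f V ∧ W = Complex.exp V

end PrimeProduct

end

/-!
# The regularized product of `p ^ log p` over the primes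

Write `a_n` for the Taylor coefficients of `f` at `0` and `c_n` for `coeff f n`, so that
`∑_{d ∣ n} c_d = n a_n` by Möbius inversion.

*Expansion.* All sums on `Re s > 1` are regroupings of absolutely convergent families. The prime
sum is `∑_p ∑_N a_N p ^ (-N s)`, an exponential sum that can be differentiated term by term
(`hasSum_iteratedDeriv_two_primePowerSum`). The choice `a_N = 1 / N` gives `log ζ` by the Euler
product, whence `(log ζ)''(s) = ∑_p ∑_k k (log p) ^ 2 p ^ (-k s)` (`hasSum_logZetaSecond`).
Inserting this in `∑ n c_n (log ζ)''(n s)` produces a family indexed by `(n, p, k)`; collecting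
the terms with `n k = N` and using Möbius inversion recovers the second derivative of the prime
sum (`primeSum_expansion`).

*Value.* At `s = 0` the series is `(log ζ)''(0) ∑ c_n n ^ (-h)`, and for `Re h` large
`∑ c_n n ^ (-h) = D(h - 1) / ζ(h)` with `D(s) = ∑ a_n n ^ (-s)` (`hasSum_coeff`). To continue `D`
to `Re s > -3`, subtract from `f` a cubic `q(x) = α x + β x ^ 2 + γ x ^ 3` with the same 2-jet
at `1`. The cubic contributes the entire function `α + β 2 ^ (-s) + γ 3 ^ (-s)`; for `g = f - q`
the Dirichlet series is `Γ(s)⁻¹ ∫ g(e ^ (-t)) t ^ (s - 1) dt`, which is holomorphic for `Re s > -3`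
since `g(e ^ (-t)) = O(t ^ 3)` at `0`, and which vanishes at `s = -2` because of the pole of `Γ`.
Hence `D(-2) = α + 4 β + 9 γ = q'(1) + q''(1) = f'(1) + f''(1)`
(`exists_dirichletSeries_continuation`). With `ζ(-1) = -1 / 12`, `ζ(0) = -1 / 2` and
`ζ'(0) = -log (2 π) / 2` the limit at `h = -1` is `f'(1) + f''(1)` times
`24 ζ''(0) + 12 (log 2 π) ^ 2`. Uniqueness is the identity theorem for meromorphic functions on a
half-plane.
-/

namespace PrimeProduct

/-! ### Exponential sums and their derivatives -/

/-- Term-by-term differentiation of an exponential sum `∑ α_i e ^ (-β_i s)` inside its half-plane of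
absolute convergence. -/
theorem hasSum_deriv_expSum {ι : Type*} {α : ι → ℂ} {β : ι → ℝ} {σ₀ : ℝ} (hβ : ∀ i, 0 ≤ β i)
    (hα : ∀ σ : ℝ, σ₀ < σ → Summable fun i => ‖α i‖ * Real.exp (-(β i * σ)))
    {s : ℂ} (hs : σ₀ < s.re) :
    AnalyticAt ℂ (fun z : ℂ => ∑' i, α i * Complex.exp (-(β i * z))) s ∧
    HasSum (fun i => α i * (-(β i : ℂ)) * Complex.exp (-(β i * s)))
      (deriv (fun z : ℂ => ∑' i, α i * Complex.exp (-(β i * z))) s) := by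
  obtain ⟨σ, h₀, h₁⟩ := exists_between hs
  have hU : IsOpen {z : ℂ | σ < z.re} := isOpen_lt continuous_const Complex.continuous_re
  have hd : ∀ i, DifferentiableOn ℂ (fun z : ℂ => α i * Complex.exp (-(β i * z)))
      {z : ℂ | σ < z.re} := fun i => by fun_prop
  have hb : ∀ i (z : ℂ), z ∈ {z : ℂ | σ < z.re} →
      ‖α i * Complex.exp (-(β i * z))‖ ≤ ‖α i‖ * Real.exp (-(β i * σ)) := by
    intro i z hz
    have hre : (-((β i : ℂ) * z)).re = -(β i * z.re) := by simp
    rw [norm_mul, Complex.norm_exp, hre]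
    have := mul_le_mul_of_nonneg_left (le_of_lt hz) (hβ i)
    gcongr
  refine ⟨(Complex.differentiableOn_tsum_of_summable_norm (hα σ h₀) hd hU hb).analyticAt
    (hU.mem_nhds h₁), ?_⟩
  refine (Complex.hasSum_deriv_of_summable_norm (hα σ h₀) hd hU hb h₁).congr_fun fun i => ?_
  have : HasDerivAt (fun z : ℂ => α i * Complex.exp (-(β i * z)))
      (α i * (Complex.exp (-(β i * s)) * (-(β i * 1)))) s :=
    ((((hasDerivAt_id s).const_mul (β i : ℂ)).neg).cexp).const_mul (α i)
  rw [this.deriv]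
  ring

theorem hasSum_iteratedDeriv_two_expSum {ι : Type*} {α : ι → ℂ} {β : ι → ℝ} {σ₀ : ℝ}
    (hβ : ∀ i, 0 ≤ β i)
    (hα : ∀ σ : ℝ, σ₀ < σ → Summable fun i => ‖α i‖ * Real.exp (-(β i * σ)))
    (hα' : ∀ σ : ℝ, σ₀ < σ → Summable fun i => ‖α i‖ * β i * Real.exp (-(β i * σ)))
    {s : ℂ} (hs : σ₀ < s.re) :
    HasSum (fun i => α i * (β i : ℂ) ^ 2 * Complex.exp (-(β i * s)))
      (iteratedDeriv 2 (fun z : ℂ => ∑' i, α i * Complex.exp (-(β i * z))) s) := by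
  have hU : IsOpen {z : ℂ | σ₀ < z.re} := isOpen_lt continuous_const Complex.continuous_re
  have hd : deriv (fun z : ℂ => ∑' i, α i * Complex.exp (-(β i * z))) =ᶠ[𝓝 s]
      fun z => ∑' i, α i * (-(β i : ℂ)) * Complex.exp (-(β i * z)) := by
    filter_upwards [hU.mem_nhds hs] with z hz
    exact (hasSum_deriv_expSum hβ hα hz).2.tsum_eq.symm
  rw [iteratedDeriv_succ, iteratedDeriv_one, hd.deriv_eq]
  refine (hasSum_deriv_expSum (σ₀ := σ₀) hβ (fun σ h => ?_) hs).2.congr_fun ?_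
  · refine (hα' σ h).congr fun i => ?_
    rw [norm_mul, norm_neg, Complex.norm_real, Real.norm_of_nonneg (hβ i)]
  · intro i; ring

/-! ### Sums over prime powers -/

/-- Polynomial growth of a sequence; the form of the bound includes `A 0 = 0`. -/
def PolyBounded (A : ℕ → ℂ) : Prop :=
  ∃ (C : ℝ) (k : ℕ), ∀ n, ‖A n‖ ≤ C * (n : ℝ) ^ (k + 1)

theorem PolyBounded.zero {A : ℕ → ℂ} (hA : PolyBounded A) : A 0 = 0 := by
  obtain ⟨C, k, h⟩ := hA
  simpa using h 0

theorem PolyBounded.mul_natCast {A : ℕ → ℂ} (hA : PolyBounded A) :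
    PolyBounded fun n => A n * n := by
  obtain ⟨C, k, h⟩ := hA
  refine ⟨C, k + 1, fun n => ?_⟩
  rw [norm_mul, Complex.norm_natCast, pow_succ _ (k + 1), ← mul_assoc]
  gcongr
  exact h n

theorem PolyBounded.summable_geometric {A : ℕ → ℂ} (hA : PolyBounded A) {r : ℝ} (h0 : 0 ≤ r)
    (h1 : r < 1) : Summable fun n => ‖A n‖ * r ^ n := by
  obtain ⟨C, k, h⟩ := hA
  have h2 : Summable fun n : ℕ => C * ((n : ℝ) ^ (k + 1) * r ^ n) :=
    (summable_pow_mul_geometric_of_norm_lt_one (k + 1)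
      (by rwa [Real.norm_of_nonneg h0])).mul_left C
  refine h2.of_nonneg_of_le (fun n => by positivity) fun n => ?_
  rw [← mul_assoc]
  gcongr
  exact h n

theorem summable_primes_log_pow_mul_exp (j : ℕ) {σ : ℝ} (hσ : 1 < σ) :
    Summable fun p : Nat.Primes => Real.log p ^ j * Real.exp (-(Real.log p * σ)) := by
  -- `log p ≤ p ^ ε / ε`, with `ε` so small that `j ε - σ < -1`
  set ε : ℝ := (σ - 1) / (2 * (j + 1)) with hε
  have hε0 : 0 < ε := by
    have : 0 < σ - 1 := by linarith
    positivity
  have hjε : j * ε < σ - 1 := by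
    rw [hε, mul_div_assoc', div_lt_iff₀ (by positivity)]
    nlinarith
  have h := (Nat.Primes.summable_rpow (r := j * ε - σ)).2 (by linarith)
  refine (h.mul_left ((1 / ε) ^ j)).of_nonneg_of_le (fun p => ?_) fun p => ?_
  · have := Real.log_natCast_nonneg (p : ℕ)
    positivity
  · have hp : (0 : ℝ) < (p : ℕ) := by exact_mod_cast p.2.pos
    have h1 : Real.log p ≤ (p : ℝ) ^ ε / ε := Real.log_le_rpow_div hp.le hε0
    have h2 : Real.exp (-(Real.log p * σ)) = (p : ℝ) ^ (-σ) := by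
      rw [Real.rpow_def_of_pos hp]; ring_nf
    have h3 : (p : ℝ) ^ (j * ε - σ) = ((p : ℝ) ^ ε) ^ j * (p : ℝ) ^ (-σ) := by
      rw [← Real.rpow_natCast, ← Real.rpow_mul hp.le, ← Real.rpow_add hp]; ring_nf
    rw [h2, h3, ← mul_assoc, ← mul_pow]
    have := Real.log_natCast_nonneg (p : ℕ)
    gcongr
    rwa [one_div_mul_eq_div]

/-- The geometric decay of `p ^ (-N σ)` in `N`, uniform in `p`. -/
theorem exp_neg_mul_log_le {p N : ℕ} (hp : p.Prime) (hN : N ≠ 0) {σ : ℝ} (hσ : 1 < σ) :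
    Real.exp (-(N * Real.log p * σ)) ≤ Real.exp (-(Real.log p * σ)) * (2 * (1 / 2) ^ N) := by
  obtain ⟨M, rfl⟩ := Nat.exists_eq_succ_of_ne_zero hN
  have h2 : Real.log 2 ≤ Real.log p :=
    Real.log_le_log (by norm_num) (by exact_mod_cast hp.two_le)
  have h3 : Real.exp (-(Real.log 2)) = 1 / 2 := by
    rw [Real.exp_neg, Real.exp_log (by norm_num)]; norm_num
  have h4 : (2 : ℝ) * (1 / 2) ^ (M.succ) = Real.exp (-(M * Real.log 2)) := by
    rw [pow_succ, ← h3, ← Real.exp_nat_mul, h3]; ring_nf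
  rw [h4, ← Real.exp_add, Real.exp_le_exp]
  have h5 : Real.log p ≤ Real.log p * σ := by
    have : 0 ≤ Real.log p := Real.log_natCast_nonneg p
    nlinarith
  have h6 : (M : ℝ) * Real.log 2 ≤ M * (Real.log p * σ) := by gcongr; linarith
  push_cast
  linarith

/-- Absolute convergence of prime power sums: by `exp_neg_mul_log_le` the family is dominated by the
product of a convergent sum over `p` and a geometrically convergent sum over `N`. -/
theorem summable_primes_nat {A : ℕ → ℂ} (hA : PolyBounded A) (j : ℕ) {σ : ℝ} (hσ : 1 < σ) :
    Summable fun q : Nat.Primes × ℕ =>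
      ‖A q.2‖ * Real.log q.1 ^ j * Real.exp (-(q.2 * Real.log q.1 * σ)) := by
  have h := (summable_primes_log_pow_mul_exp j hσ).mul_of_nonneg
    ((hA.summable_geometric (r := 1 / 2) (by norm_num) (by norm_num)).mul_left 2)
    (fun p => by have := Real.log_natCast_nonneg (p : ℕ); positivity)
    (fun n => by positivity)
  refine h.of_nonneg_of_le (fun q => ?_) fun q => ?_
  · have := Real.log_natCast_nonneg (q.1 : ℕ)
    positivity
  · have hl := Real.log_natCast_nonneg (q.1 : ℕ)
    rcases eq_or_ne q.2 0 with h0 | h0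
    · rw [h0, hA.zero]; simp
    · calc _ ≤ ‖A q.2‖ * Real.log q.1 ^ j *
            (Real.exp (-(Real.log q.1 * σ)) * (2 * (1 / 2) ^ q.2)) := by
            gcongr; exact exp_neg_mul_log_le q.1.2 h0 hσ
        _ = _ := by ring

/-- The sum `∑_p ∑_N A_N p ^ (-N s)`. -/
noncomputable def primePowerSum (A : ℕ → ℂ) (s : ℂ) : ℂ :=
  ∑' q : Nat.Primes × ℕ, A q.2 * Complex.exp (-((q.2 * Real.log q.1 : ℝ) * s))

theorem natCast_log_nonneg (q : Nat.Primes × ℕ) : (0 : ℝ) ≤ q.2 * Real.log q.1 :=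
  mul_nonneg (Nat.cast_nonneg _) (Real.log_natCast_nonneg _)

theorem summable_norm_primePowerSum {A : ℕ → ℂ} (hA : PolyBounded A) {σ : ℝ} (hσ : 1 < σ) :
    Summable fun q : Nat.Primes × ℕ =>
      ‖A q.2‖ * Real.exp (-(q.2 * Real.log q.1 * σ)) := by
  simpa using summable_primes_nat hA 0 hσ

theorem analyticAt_primePowerSum {A : ℕ → ℂ} (hA : PolyBounded A) {s : ℂ} (hs : 1 < s.re) :
    AnalyticAt ℂ (primePowerSum A) s :=
  (hasSum_deriv_expSum (α := fun q : Nat.Primes × ℕ => A q.2) natCast_log_nonneg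
    (fun _ h => summable_norm_primePowerSum hA h) hs).1

theorem hasSum_iteratedDeriv_two_primePowerSum {A : ℕ → ℂ} (hA : PolyBounded A) {s : ℂ}
    (hs : 1 < s.re) :
    HasSum (fun q : Nat.Primes × ℕ => A q.2 * ((q.2 * Real.log q.1 : ℝ) : ℂ) ^ 2 *
      Complex.exp (-((q.2 * Real.log q.1 : ℝ) * s))) (iteratedDeriv 2 (primePowerSum A) s) := by
  refine hasSum_iteratedDeriv_two_expSum (α := fun q : Nat.Primes × ℕ => A q.2) natCast_log_nonneg
    (fun _ h => summable_norm_primePowerSum hA h) (fun σ h => ?_) hs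
  refine (summable_primes_nat hA.mul_natCast 1 h).congr fun q => ?_
  rw [norm_mul, Complex.norm_natCast]
  ring

theorem summable_primePowerSum {A : ℕ → ℂ} (hA : PolyBounded A) {s : ℂ} (hs : 1 < s.re) :
    Summable fun q : Nat.Primes × ℕ =>
      A q.2 * Complex.exp (-((q.2 * Real.log q.1 : ℝ) * s)) := by
  refine Summable.of_norm ((summable_norm_primePowerSum hA hs).congr fun q => ?_)
  rw [norm_mul, Complex.norm_exp, Complex.neg_re, Complex.re_ofReal_mul]

/-- The exponential form used for term-by-term differentiation is `(p ^ (-s)) ^ N`. -/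
theorem exp_neg_natCast_mul_log {p : ℕ} (hp : p.Prime) (N : ℕ) (s : ℂ) :
    Complex.exp (-((N * Real.log p : ℝ) * s)) = ((p : ℂ) ^ (-s)) ^ N := by
  rw [Complex.cpow_def_of_ne_zero (by exact_mod_cast hp.ne_zero), ← Complex.exp_nat_mul]
  rw [← Complex.natCast_log]
  push_cast
  ring_nf

theorem norm_prime_cpow_lt {p : ℕ} (hp : p.Prime) {s : ℂ} (hs : 0 < s.re) :
    ‖(p : ℂ) ^ (-s)‖ < 1 := by
  rw [Complex.norm_natCast_cpow_of_pos hp.pos]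
  exact Real.rpow_lt_one_of_one_lt_of_neg (by exact_mod_cast hp.one_lt) (by simpa)

/-- If `F` has the power series `∑ A_N x ^ N` on the disc, then `∑_p F(p ^ (-s))` is the
corresponding sum over prime powers. -/
theorem hasSum_primes_primePowerSum {A : ℕ → ℂ} (hA : PolyBounded A) {F : ℂ → ℂ}
    (hF : ∀ x : ℂ, ‖x‖ < 1 → HasSum (fun n => A n * x ^ n) (F x)) {s : ℂ} (hs : 1 < s.re) :
    HasSum (fun p : Nat.Primes => F ((p : ℂ) ^ (-s))) (primePowerSum A s) := by
  refine (summable_primePowerSum hA hs).hasSum.prod_fiberwise fun p => ?_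
  simp only [exp_neg_natCast_mul_log p.2]
  exact hF _ (norm_prime_cpow_lt p.2 (by linarith))

/-! ### The second derivative of `log ζ` -/

theorem polyBounded_one_div : PolyBounded fun n => 1 / (n : ℂ) := by
  refine ⟨1, 0, fun n => ?_⟩
  rcases eq_or_ne n 0 with rfl | hn
  · simp
  · have : (1 : ℝ) ≤ n := by exact_mod_cast Nat.one_le_iff_ne_zero.2 hn
    rw [norm_div, norm_one, Complex.norm_natCast, one_mul, zero_add, pow_one,
      div_le_iff₀ (by linarith)]
    nlinarith

/-- The Euler product in logarithmic form: `∑_p ∑_N p ^ (-N s) / N` is a logarithm of `ζ(s)`. -/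
theorem exp_primePowerSum_one_div {s : ℂ} (hs : 1 < s.re) :
    Complex.exp (primePowerSum (fun n => 1 / (n : ℂ)) s) = riemannZeta s := by
  rw [← riemannZeta_eulerProduct_exp_log hs]
  congr 1
  refine (HasSum.tsum_eq (hasSum_primes_primePowerSum polyBounded_one_div
    (F := fun x => -Complex.log (1 - x)) (fun x hx => ?_) hs)).symm
  simpa [one_div, div_eq_inv_mul] using Complex.hasSum_taylorSeries_neg_log hx

/-- `logZetaSecond` is the second derivative of the logarithm of `ζ` given by the Euler product. -/
theorem logZetaSecond_eq {s : ℂ} (hs : 1 < s.re) :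
    logZetaSecond s = iteratedDeriv 2 (primePowerSum fun n => 1 / (n : ℂ)) s := by
  set S := primePowerSum fun n => 1 / (n : ℂ) with hS
  have hU : IsOpen {z : ℂ | 1 < z.re} := isOpen_lt continuous_const Complex.continuous_re
  have hana : ∀ z : ℂ, 1 < z.re → AnalyticAt ℂ S z :=
    fun z hz => analyticAt_primePowerSum polyBounded_one_div hz
  have h0 : ∀ z : ℂ, 1 < z.re → riemannZeta =ᶠ[𝓝 z] fun w => Complex.exp (S w) := by
    intro z hz
    filter_upwards [hU.mem_nhds hz] with w hw using (exp_primePowerSum_one_div hw).symm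
  have h1 : ∀ z : ℂ, 1 < z.re → deriv riemannZeta z = Complex.exp (S z) * deriv S z := by
    intro z hz
    rw [(h0 z hz).deriv_eq]
    exact (hana z hz).differentiableAt.hasDerivAt.cexp.deriv
  have h1' : deriv riemannZeta =ᶠ[𝓝 s] fun w => Complex.exp (S w) * deriv S w := by
    filter_upwards [hU.mem_nhds hs] with w hw using h1 w hw
  have h2 : iteratedDeriv 2 riemannZeta s =
      Complex.exp (S s) * deriv S s * deriv S s + Complex.exp (S s) * iteratedDeriv 2 S s := by
    rw [iteratedDeriv_succ, iteratedDeriv_one, h1'.deriv_eq, iteratedDeriv_succ, iteratedDeriv_one]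
    exact ((hana s hs).differentiableAt.hasDerivAt.cexp.mul
      (hana s hs).deriv.differentiableAt.hasDerivAt).deriv
  rw [logZetaSecond, h2, h1 s hs, (h0 s hs).eq_of_nhds]
  have := Complex.exp_ne_zero (S s)
  field_simp
  ring

theorem hasSum_logZetaSecond {s : ℂ} (hs : 1 < s.re) :
    HasSum (fun q : Nat.Primes × ℕ => (q.2 : ℂ) * (Real.log q.1 : ℂ) ^ 2 *
      Complex.exp (-((q.2 * Real.log q.1 : ℝ) * s))) (logZetaSecond s) := by
  rw [logZetaSecond_eq hs]
  refine (hasSum_iteratedDeriv_two_primePowerSum polyBounded_one_div hs).congr_fun fun q => ?_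
  rcases eq_or_ne (q.2 : ℂ) 0 with h | h
  · simp [h]
  · push_cast
    field_simp

/-! ### Taylor coefficients and the coefficients `c_n` -/

/-- The Taylor coefficients of `f` at `0`. -/
noncomputable def taylorCoeff (f : ℂ → ℂ) (n : ℕ) : ℂ :=
  iteratedDeriv n f 0 / (Nat.factorial n : ℂ)

theorem hasSum_taylorCoeff {f : ℂ → ℂ} (hf : DifferentiableOn ℂ f (Metric.ball 0 1)) {x : ℂ}
    (hx : ‖x‖ < 1) : HasSum (fun n => taylorCoeff f n * x ^ n) (f x) := by
  refine (Complex.hasSum_taylorSeries_on_ball (c := 0) (r := 1) (f := f) (by simpa using hf)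
    (z := x) (by simpa using hx)).congr_fun fun n => ?_
  simp only [taylorCoeff, smul_eq_mul, sub_zero]
  ring

theorem polyBounded_taylorCoeff {f : ℂ → ℂ} (hf0 : f 0 = 0)
    (hgrowth : ∃ k : ℕ, (fun n : ℕ => iteratedDeriv n f 0 / (Nat.factorial n : ℂ))
      =O[atTop] (fun n : ℕ => (n : ℝ) ^ k)) : PolyBounded (taylorCoeff f) := by
  obtain ⟨k, hk⟩ := hgrowth
  obtain ⟨C, hC, h⟩ := Asymptotics.bound_of_isBigO_nat_atTop hk
  refine ⟨C, k, fun n => ?_⟩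
  rcases eq_or_ne n 0 with rfl | hn
  · simp [taylorCoeff, hf0]
  · have h1 : (1 : ℝ) ≤ n := by exact_mod_cast Nat.one_le_iff_ne_zero.2 hn
    have h2 := h (x := n) (by positivity)
    rw [Real.norm_of_nonneg (by positivity)] at h2
    refine h2.trans ?_
    gcongr
    exact Nat.le_succ k

theorem coeff_eq (f : ℂ → ℂ) (n : ℕ) : coeff f n =
    ∑ x ∈ n.divisorsAntidiagonal,
      taylorCoeff f x.1 * x.1 * ((ArithmeticFunction.moebius x.2 : ℤ) : ℂ) := by
  rw [Nat.sum_divisorsAntidiagonal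
    (fun a b => taylorCoeff f a * a * ((ArithmeticFunction.moebius b : ℤ) : ℂ))]
  rfl

/-- Möbius inversion of the definition of `c_n`. -/
theorem sum_divisors_coeff (f : ℂ → ℂ) {n : ℕ} (hn : 0 < n) :
    ∑ d ∈ n.divisors, coeff f d = taylorCoeff f n * n := by
  refine (ArithmeticFunction.sum_eq_iff_sum_mul_moebius_eq (f := coeff f)
    (g := fun n => taylorCoeff f n * n)).2 (fun n _ => ?_) n hn
  rw [coeff_eq, Nat.sum_divisorsAntidiagonal'
    (fun a b => taylorCoeff f a * a * ((ArithmeticFunction.moebius b : ℤ) : ℂ)),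
    Nat.sum_divisorsAntidiagonal
    (fun a b => ((ArithmeticFunction.moebius a : ℤ) : ℂ) * (taylorCoeff f b * b))]
  exact Finset.sum_congr rfl fun d _ => mul_comm _ _

theorem polyBounded_coeff {f : ℂ → ℂ} (hA : PolyBounded (taylorCoeff f)) :
    PolyBounded (coeff f) := by
  obtain ⟨C, k, h⟩ := hA
  have hC : 0 ≤ C := by simpa using (norm_nonneg _).trans (h 1)
  refine ⟨C, k + 2, fun n => ?_⟩
  have hb : ∀ d ∈ n.divisors, ‖iteratedDeriv d f 0 / (Nat.factorial d : ℂ) * (d : ℂ) *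
      ((ArithmeticFunction.moebius (n / d) : ℤ) : ℂ)‖ ≤ C * (n : ℝ) ^ (k + 2) := by
    intro d hd
    have hdn : (d : ℝ) ≤ n := by exact_mod_cast Nat.divisor_le hd
    have hμ : ‖((ArithmeticFunction.moebius (n / d) : ℤ) : ℂ)‖ ≤ 1 := by
      rw [Complex.norm_intCast]
      exact_mod_cast ArithmeticFunction.abs_moebius_le_one
    calc _ ≤ C * (d : ℝ) ^ (k + 1) * d * 1 := by
          rw [norm_mul, norm_mul, Complex.norm_natCast]
          gcongr
          exact h d
      _ = C * (d : ℝ) ^ (k + 2) := by ring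
      _ ≤ _ := by gcongr
  calc ‖coeff f n‖ ≤ ∑ d ∈ n.divisors, C * (n : ℝ) ^ (k + 2) := norm_sum_le_of_le _ hb
    _ = n.divisors.card * (C * (n : ℝ) ^ (k + 2)) := by rw [Finset.sum_const, nsmul_eq_mul]
    _ ≤ n * (C * (n : ℝ) ^ (k + 2)) := by
        gcongr
        exact Nat.card_divisors_le_self n
    _ = _ := by ring

/-! ### The two expansions of the second derivative -/

theorem iteratedDeriv_two_comp_prime_cpow {f : ℂ → ℂ}
    (hf : DifferentiableOn ℂ f (Metric.ball 0 1)) (p : Nat.Primes) {s : ℂ} (hs : 0 < s.re) :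
    iteratedDeriv 2 (fun z : ℂ => f ((p : ℂ) ^ (-z))) s = primeTerm f s p := by
  have hp : (p : ℂ) ≠ 0 := by exact_mod_cast p.2.ne_zero
  have hU : IsOpen {z : ℂ | 0 < z.re} := isOpen_lt continuous_const Complex.continuous_re
  have hana : ∀ z : ℂ, 0 < z.re → AnalyticAt ℂ f ((p : ℂ) ^ (-z)) := fun z hz =>
    hf.analyticAt (Metric.isOpen_ball.mem_nhds (by simpa using norm_prime_cpow_lt p.2 hz))
  have hpow : ∀ z : ℂ, HasDerivAt (fun z : ℂ => (p : ℂ) ^ (-z))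
      ((p : ℂ) ^ (-z) * Complex.log p * (-1)) z := fun z =>
    (hasDerivAt_neg z).const_cpow (Or.inl hp)
  have h1 : deriv (fun z : ℂ => f ((p : ℂ) ^ (-z))) =ᶠ[𝓝 s]
      fun z => deriv f ((p : ℂ) ^ (-z)) * ((p : ℂ) ^ (-z) * Complex.log p * (-1)) := by
    filter_upwards [hU.mem_nhds hs] with z hz
    exact ((hana z hz).differentiableAt.hasDerivAt.comp z (hpow z)).deriv
  have h2 := ((hana s hs).deriv.differentiableAt.hasDerivAt.comp s (hpow s)).mul
    (((hpow s).mul_const (Complex.log p)).mul_const (-1))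
  rw [iteratedDeriv_succ, iteratedDeriv_one, h1.deriv_eq]
  refine h2.deriv.trans ?_
  rw [Function.comp_apply, primeTerm, iteratedDeriv_succ, iteratedDeriv_one, ← Complex.natCast_log,
    show -(2 * s) = -s + -s by ring, Complex.cpow_add _ _ hp]
  ring

/-- The second derivative of `s ↦ f(p ^ (-s))`, computed from its expansion in powers of `p ^ (-s)`,
is the value `primeTerm` given by the chain rule. -/
theorem hasSum_fiber_primeTerm {f : ℂ → ℂ} (hf : DifferentiableOn ℂ f (Metric.ball 0 1))
    (hA : PolyBounded (taylorCoeff f)) (p : Nat.Primes) {s : ℂ} (hs : 1 < s.re) :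
    HasSum (fun n : ℕ => taylorCoeff f n * ((n * Real.log p : ℝ) : ℂ) ^ 2 *
      Complex.exp (-((n * Real.log p : ℝ) * s))) (primeTerm f s p) := by
  rw [← iteratedDeriv_two_comp_prime_cpow hf p (by linarith)]
  have hU : IsOpen {z : ℂ | 1 < z.re} := isOpen_lt continuous_const Complex.continuous_re
  have hE : (fun z : ℂ => f ((p : ℂ) ^ (-z))) =ᶠ[𝓝 s] fun z : ℂ =>
      ∑' n : ℕ, taylorCoeff f n * Complex.exp (-((n * Real.log p : ℝ) * z)) := by
    filter_upwards [hU.mem_nhds hs] with z hz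
    simp only [exp_neg_natCast_mul_log p.2]
    have hz0 : 0 < z.re := zero_lt_one.trans hz
    exact (hasSum_taylorCoeff hf (norm_prime_cpow_lt p.2 hz0)).tsum_eq.symm
  rw [hE.iteratedDeriv_eq 2]
  refine hasSum_iteratedDeriv_two_expSum (σ₀ := 1) (α := taylorCoeff f)
    (β := fun n : ℕ => n * Real.log p)
    (fun n => natCast_log_nonneg (p, n)) (fun σ h => ?_) (fun σ h => ?_) hs
  · exact (summable_norm_primePowerSum hA h).prod_factor p
  · refine ((summable_primes_nat hA.mul_natCast 1 h).prod_factor p).congr fun n => ?_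
    simp only [norm_mul, Complex.norm_natCast]
    ring

/-- The common refinement of the two expansions: the family indexed by `(n, (p, k))` obtained by
inserting the expansion of `(log ζ)''` into the `zetaTerm`s. -/
noncomputable def tripleTerm (f : ℂ → ℂ) (s : ℂ) (x : ℕ × Nat.Primes × ℕ) : ℂ :=
  coeff f x.1 * x.1 * (x.2.2 * (Real.log x.2.1 : ℂ) ^ 2 *
    Complex.exp (-((x.2.2 * Real.log x.2.1 : ℝ) * (x.1 * s))))

/-- Used to decouple the variables `n` and `k` in `p ^ (-n k s)`. -/
theorem half_pow_mul_le {m n : ℕ} (hm : m ≠ 0) (hn : n ≠ 0) :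
    (1 / 2 : ℝ) ^ (m * n) ≤ 2 * ((1 / 2) ^ m * (1 / 2) ^ n) := by
  have h : m + n ≤ m * n + 1 := by
    obtain ⟨a, rfl⟩ := Nat.exists_eq_succ_of_ne_zero hm
    obtain ⟨b, rfl⟩ := Nat.exists_eq_succ_of_ne_zero hn
    simp only [Nat.succ_eq_add_one]
    nlinarith [Nat.zero_le (a * b)]
  have := pow_le_pow_of_le_one (by norm_num : (0 : ℝ) ≤ 1 / 2) (by norm_num) h
  rw [pow_add, pow_add, pow_one] at this
  linarith

theorem summable_tripleTerm {f : ℂ → ℂ} (hA : PolyBounded (coeff f)) {s : ℂ} (hs : 1 < s.re) :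
    Summable (tripleTerm f s) := by
  have hN : PolyBounded fun n => (n : ℂ) := ⟨1, 0, fun n => by simp⟩
  have hsum := (((hA.mul_natCast.summable_geometric (r := 1 / 2) (by norm_num)
    (by norm_num)).mul_left 4)).mul_of_nonneg
    ((summable_primes_log_pow_mul_exp 2 hs).mul_of_nonneg
      (hN.summable_geometric (r := 1 / 2) (by norm_num) (by norm_num))
      (fun p => by positivity) (fun n => by positivity))
    (fun n => by positivity) (fun p => by positivity)
  refine Summable.of_norm_bounded hsum fun ⟨n, p, k⟩ => ?_
  rcases eq_or_ne n 0 with rfl | hn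
  · simp [tripleTerm]
  rcases eq_or_ne k 0 with rfl | hk
  · simp [tripleTerm]
  have hl := Real.log_natCast_nonneg (p : ℕ)
  have he : ‖Complex.exp (-((k * Real.log p : ℝ) * (n * s)))‖ =
      Real.exp (-((n * k : ℕ) * Real.log p * s.re)) := by
    rw [Complex.norm_exp, Complex.neg_re, Complex.re_ofReal_mul, ← Complex.ofReal_natCast n, Complex.re_ofReal_mul]
    push_cast
    ring_nf
  have he2 := exp_neg_mul_log_le p.2 (mul_ne_zero hn hk) hs
  have he3 := half_pow_mul_le hn hk
  simp only [tripleTerm, norm_mul, he, norm_pow, Complex.norm_real, Real.norm_of_nonneg hl,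
    Complex.norm_natCast]
  calc _ ≤ ‖coeff f n‖ * n * (k * Real.log p ^ 2 *
        (Real.exp (-(Real.log p * s.re)) * (2 * (2 * ((1 / 2) ^ n * (1 / 2) ^ k))))) := by
        gcongr
        exact he2.trans (by gcongr)
    _ = _ := by ring

theorem hasSum_zetaTerm_tripleTerm {f : ℂ → ℂ} {s T : ℂ} (hs : 1 < s.re)
    (hT : HasSum (tripleTerm f s) T) : HasSum (zetaTerm f (-1) s) T := by
  refine hT.prod_fiberwise fun n => ?_
  rcases eq_or_ne n 0 with rfl | hn
  · simp [tripleTerm, zetaTerm]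
  · have h1 : (1 : ℝ) ≤ n := by exact_mod_cast Nat.one_le_iff_ne_zero.2 hn
    have hre : 1 < ((n : ℂ) * s).re := by
      rw [← Complex.ofReal_natCast, Complex.re_ofReal_mul]
      nlinarith
    rw [zetaTerm, neg_neg, Complex.cpow_one]
    exact (hasSum_logZetaSecond hre).mul_left (coeff f n * n)

/-- Grouping the triple family by `(p, n * k)` gives the expansion over prime powers. -/
theorem hasSum_primePower_tripleTerm {f : ℂ → ℂ} (hA0 : taylorCoeff f 0 = 0) {s T : ℂ}
    (hT : HasSum (tripleTerm f s) T) :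
    HasSum (fun q : Nat.Primes × ℕ => taylorCoeff f q.2 * ((q.2 * Real.log q.1 : ℝ) : ℂ) ^ 2 *
      Complex.exp (-((q.2 * Real.log q.1 : ℝ) * s))) T := by
  classical
  have h := hT.tsum_fiberwise fun x : ℕ × Nat.Primes × ℕ => (x.2.1, x.1 * x.2.2)
  refine h.congr_fun fun ⟨p, N⟩ => ?_
  rw [tsum_subtype ((fun x : ℕ × Nat.Primes × ℕ => (x.2.1, x.1 * x.2.2)) ⁻¹' {(p, N)})
    (tripleTerm f s)]
  -- for `N = 0` the fibre is infinite, but all its terms vanish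
  rcases Nat.eq_zero_or_pos N with rfl | hN
  · simp only [hA0, zero_mul]
    refine ((tsum_congr fun x => ?_).trans tsum_zero).symm
    refine Set.indicator_apply_eq_zero.2 fun hx => ?_
    have h0 : x.1 * x.2.2 = 0 := (Prod.ext_iff.1 hx).2
    rcases mul_eq_zero.1 h0 with h | h <;> simp [tripleTerm, h]
  · have hinj : Function.Injective fun y : ℕ × ℕ => (y.1, p, y.2) := by
      intro y z hyz
      simp only [Prod.mk.injEq, true_and] at hyz
      exact Prod.ext hyz.1 hyz.2
    rw [tsum_eq_sum (s := N.divisorsAntidiagonal.map ⟨_, hinj⟩)]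
    · rw [Finset.sum_map]
      have hterm : ∀ y ∈ N.divisorsAntidiagonal,
          ((fun x : ℕ × Nat.Primes × ℕ => (x.2.1, x.1 * x.2.2)) ⁻¹' {(p, N)}).indicator
            (tripleTerm f s) (y.1, p, y.2) =
          coeff f y.1 * (N * (Real.log p : ℂ) ^ 2 *
            Complex.exp (-((N * Real.log p : ℝ) * s))) := by
        intro y hy
        have hyN : y.1 * y.2 = N := (Nat.mem_divisorsAntidiagonal.1 hy).1
        rw [Set.indicator_of_mem (by simp [hyN]), tripleTerm, ← hyN]
        push_cast
        ring_nf
      refine (Eq.trans (Finset.sum_congr rfl hterm) ?_).symm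
      rw [← Finset.sum_mul, Nat.sum_divisorsAntidiagonal (fun a _ => coeff f a),
        sum_divisors_coeff f hN]
      push_cast
      ring
    · rintro ⟨n, p', k⟩ hx
      refine Set.indicator_of_notMem (fun hmem => hx ?_) _
      obtain ⟨rfl, rfl⟩ := Prod.ext_iff.1 (Set.mem_singleton_iff.1 hmem)
      simp only [Finset.mem_map, Nat.mem_divisorsAntidiagonal, Function.Embedding.coeFn_mk]
      exact ⟨(n, k), ⟨rfl, hN.ne'⟩, rfl⟩

/-- The expansion part of the regularization holds for every admissible `f`. -/
theorem primeSum_expansion {f : ℂ → ℂ} (hf : DifferentiableOn ℂ f (Metric.ball 0 1))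
    (hA : PolyBounded (taylorCoeff f)) {s : ℂ} (hs : 1 < s.re) :
    Summable (fun p : Nat.Primes => f ((p : ℂ) ^ (-s))) ∧
    AnalyticAt ℂ (primeSum f) s ∧
    HasSum (primeTerm f s) (iteratedDeriv 2 (primeSum f) s) ∧
    HasSum (zetaTerm f (-1) s) (iteratedDeriv 2 (primeSum f) s) := by
  have hsum : ∀ z : ℂ, 1 < z.re →
      HasSum (fun p : Nat.Primes => f ((p : ℂ) ^ (-z))) (primePowerSum (taylorCoeff f) z) :=
    fun z hz => hasSum_primes_primePowerSum hA (fun x hx => hasSum_taylorCoeff hf hx) hz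
  have hU : IsOpen {z : ℂ | 1 < z.re} := isOpen_lt continuous_const Complex.continuous_re
  have heq : primeSum f =ᶠ[𝓝 s] primePowerSum (taylorCoeff f) := by
    filter_upwards [hU.mem_nhds hs] with z hz using (hsum z hz).tsum_eq
  have h2 := hasSum_iteratedDeriv_two_primePowerSum hA hs
  rw [heq.iteratedDeriv_eq 2]
  refine ⟨(hsum s hs).summable, (analyticAt_primePowerSum hA hs).congr heq.symm,
    h2.prod_fiberwise fun p => hasSum_fiber_primeTerm hf hA p hs, ?_⟩
  have hT := (summable_tripleTerm (polyBounded_coeff hA) hs).hasSum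
  rw [h2.unique (hasSum_primePower_tripleTerm hA.zero hT)]
  exact hasSum_zetaTerm_tripleTerm hs hT

/-! ### Continuation of the Dirichlet series `∑ a_n n ^ (-s)` -/

theorem PolyBounded.sub {A B : ℕ → ℂ} (hA : PolyBounded A) (hB : PolyBounded B) :
    PolyBounded fun n => A n - B n := by
  obtain ⟨C, k, h⟩ := hA
  obtain ⟨C', k', h'⟩ := hB
  have hC : 0 ≤ C := by simpa using (norm_nonneg _).trans (h 1)
  have hC' : 0 ≤ C' := by simpa using (norm_nonneg _).trans (h' 1)
  refine ⟨C + C', max k k', fun n => ?_⟩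
  rcases eq_or_ne n 0 with rfl | hn
  · have h0 := h 0
    have h0' := h' 0
    simp only [CharP.cast_eq_zero, zero_pow (Nat.succ_ne_zero _), mul_zero, norm_le_zero_iff]
      at h0 h0'
    simp [h0, h0']
  · have h1 : (1 : ℝ) ≤ n := by exact_mod_cast Nat.one_le_iff_ne_zero.2 hn
    calc ‖A n - B n‖ ≤ C * (n : ℝ) ^ (k + 1) + C' * (n : ℝ) ^ (k' + 1) :=
          (norm_sub_le _ _).trans (add_le_add (h n) (h' n))
      _ ≤ C * (n : ℝ) ^ (max k k' + 1) + C' * (n : ℝ) ^ (max k k' + 1) := by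
          gcongr
          · exact le_max_left _ _
          · exact le_max_right _ _
      _ = _ := by ring

theorem polyBounded_single {m : ℕ} (hm : m ≠ 0) (c : ℂ) : PolyBounded (Pi.single m c) := by
  refine ⟨‖c‖, 0, fun n => ?_⟩
  rcases eq_or_ne n m with rfl | h
  · have h1 : (1 : ℝ) ≤ n := by exact_mod_cast Nat.one_le_iff_ne_zero.2 hm
    rw [Pi.single_eq_same, zero_add, pow_one]
    exact le_mul_of_one_le_right (norm_nonneg _) h1
  · rw [Pi.single_eq_of_ne h]
    simpa using by positivity

theorem PolyBounded.summable_norm_div_rpow {A : ℕ → ℂ} (hA : PolyBounded A) :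
    ∃ σ₁ : ℝ, 0 < σ₁ ∧ ∀ σ : ℝ, σ₁ < σ → Summable fun n : ℕ => ‖A n‖ / (n : ℝ) ^ σ := by
  obtain ⟨C, k, h⟩ := hA
  refine ⟨k + 2, by positivity, fun σ hσ => ?_⟩
  refine ((Real.summable_nat_rpow.2 (show (k + 1 : ℝ) - σ < -1 by linarith)).mul_left
    C).of_nonneg_of_le (fun n => by positivity) fun n => ?_
  rcases eq_or_ne n 0 with rfl | hn
  · have h0 : A 0 = 0 := by simpa using h 0
    have h1 : (k + 1 : ℝ) - σ ≠ 0 := by linarith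
    simp [h0, Real.zero_rpow h1]
  · have hn' : (0 : ℝ) < n := by exact_mod_cast Nat.pos_of_ne_zero hn
    rw [Real.rpow_sub hn', ← mul_div_assoc]
    gcongr
    exact_mod_cast h n

theorem norm_ofReal_exp_neg_lt_one {t : ℝ} (ht : 0 < t) : ‖((Real.exp (-t) : ℝ) : ℂ)‖ < 1 := by
  rw [Complex.norm_real, Real.norm_of_nonneg (Real.exp_pos _).le, Real.exp_lt_one_iff]
  linarith

section Mellin

variable {A : ℕ → ℂ} {g : ℂ → ℂ}

theorem continuousOn_comp_exp_neg (hg : DifferentiableOn ℂ g (Metric.ball 0 1)) :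
    ContinuousOn (fun t : ℝ => g (Real.exp (-t) : ℝ)) (Set.Ioi 0) := by
  refine hg.continuousOn.comp (by fun_prop) fun t ht => ?_
  simpa only [mem_ball_zero_iff] using norm_ofReal_exp_neg_lt_one ht

theorem isBigO_comp_exp_neg_atTop (hg : DifferentiableOn ℂ g (Metric.ball 0 1)) (hg0 : g 0 = 0) :
    (fun t : ℝ => g (Real.exp (-t) : ℝ)) =O[atTop] fun t => Real.exp (-1 * t) := by
  have h : g =O[𝓝 0] fun x => x := by
    simpa [hg0] using (hg.differentiableAt (Metric.ball_mem_nhds 0 one_pos)).isBigO_sub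
  have ht : Tendsto (fun t : ℝ => ((Real.exp (-t) : ℝ) : ℂ)) atTop (𝓝 0) := by
    have := (Complex.continuous_ofReal.tendsto 0).comp
      (Real.tendsto_exp_atBot.comp tendsto_neg_atTop_atBot)
    rwa [Complex.ofReal_zero] at this
  refine (h.comp_tendsto ht).trans (Asymptotics.IsBigO.of_norm_le fun t => ?_)
  rw [Function.comp_apply, Complex.norm_real, Real.norm_of_nonneg (Real.exp_pos _).le,
    neg_one_mul]

theorem isBigO_comp_exp_neg_nhdsGT {m : ℕ} (hg : g =O[𝓝 1] fun x => (x - 1) ^ m) :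
    (fun t : ℝ => g (Real.exp (-t) : ℝ)) =O[𝓝[>] 0] fun t => t ^ (-(-m : ℝ)) := by
  have ht : Tendsto (fun t : ℝ => ((Real.exp (-t) : ℝ) : ℂ)) (𝓝[>] 0) (𝓝 1) := by
    have : Continuous fun t : ℝ => ((Real.exp (-t) : ℝ) : ℂ) := by fun_prop
    simpa using (this.tendsto 0).mono_left nhdsWithin_le_nhds
  refine (hg.comp_tendsto ht).trans (Asymptotics.IsBigO.of_bound 1 ?_)
  filter_upwards [self_mem_nhdsWithin] with t (h0 : 0 < t)
  have h1 : ‖((Real.exp (-t) : ℝ) : ℂ) - 1‖ ≤ t := by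
    rw [← Complex.ofReal_one, ← Complex.ofReal_sub, Complex.norm_real, Real.norm_eq_abs, abs_le]
    have h2 := Real.add_one_le_exp (-t)
    have h3 : Real.exp (-t) ≤ 1 := Real.exp_le_one_iff.2 (by linarith)
    constructor <;> linarith
  rw [Function.comp_apply, norm_pow, neg_neg, Real.rpow_natCast, norm_pow,
    Real.norm_of_nonneg h0.le, one_mul]
  gcongr

/-- If `g(x) = ∑ A_n x ^ n` vanishes to order `m` at `1`, the Mellin transform of `g(e^{-t})`
divided by `Γ` continues `∑ A_n n ^ (-s)` to `Re s > -m`. -/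
theorem mellin_continuation (hA : PolyBounded A) (hg : DifferentiableOn ℂ g (Metric.ball 0 1))
    (hAg : ∀ x : ℂ, ‖x‖ < 1 → HasSum (fun n => A n * x ^ n) (g x))
    {m : ℕ} (hg1 : g =O[𝓝 1] fun x => (x - 1) ^ m) :
    DifferentiableOn ℂ (fun s => mellin (fun t : ℝ => g (Real.exp (-t) : ℝ)) s * (Complex.Gamma s)⁻¹)
      {s : ℂ | -(m : ℝ) < s.re} ∧
    ∃ σ₁ : ℝ, ∀ s : ℂ, σ₁ < s.re → HasSum (fun n : ℕ => A n * (n : ℂ) ^ (-s))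
      (mellin (fun t : ℝ => g (Real.exp (-t) : ℝ)) s * (Complex.Gamma s)⁻¹) := by
  have hg0 : g 0 = 0 := by
    have h := hAg 0 (by simp)
    have h' : HasSum (fun n => A n * (0 : ℂ) ^ n) 0 := by
      refine hasSum_zero.congr_fun fun n => ?_
      rcases eq_or_ne n 0 with rfl | hn
      · simp [hA.zero]
      · simp [hn]
    exact h.unique h'
  refine ⟨fun s hs => ?_, ?_⟩
  · refine ((mellin_differentiableAt_of_isBigO_rpow_exp one_pos
      ((continuousOn_comp_exp_neg hg).locallyIntegrableOn measurableSet_Ioi)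
      (isBigO_comp_exp_neg_atTop hg hg0) (isBigO_comp_exp_neg_nhdsGT hg1) hs).mul ?_
      ).differentiableWithinAt
    exact Complex.differentiable_one_div_Gamma s
  · obtain ⟨σ₁, h0, h1⟩ := hA.summable_norm_div_rpow
    refine ⟨σ₁, fun s hs => ?_⟩
    have hs0 : 0 < s.re := h0.trans hs
    have hΓ := Complex.Gamma_ne_zero_of_re_pos hs0
    have h := hasSum_mellin (a := A) (p := fun n : ℕ => (n : ℝ))
      (F := fun t : ℝ => g (Real.exp (-t) : ℝ)) (s := s) (fun n => ?_) hs0 (fun t ht => ?_)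
      (h1 _ hs)
    · refine (h.mul_right (Complex.Gamma s)⁻¹).congr_fun fun n => ?_
      rw [Complex.cpow_neg, Complex.ofReal_natCast]
      field_simp
    · rcases eq_or_ne n 0 with rfl | hn
      · exact Or.inl hA.zero
      · exact Or.inr (by exact_mod_cast Nat.pos_of_ne_zero hn)
    · refine (hAg _ (norm_ofReal_exp_neg_lt_one ht)).congr_fun fun n => ?_
      rw [← Complex.ofReal_pow, ← Real.exp_nat_mul]
      ring_nf

end Mellin

theorem isBigO_sub_one_pow_three {g : ℂ → ℂ} (hg : AnalyticAt ℂ g 1) (h0 : g 1 = 0)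
    (h1 : deriv g 1 = 0) (h2 : iteratedDeriv 2 g 1 = 0) :
    g =O[𝓝 1] fun x => (x - 1) ^ 3 := by
  have h : ((3 : ℕ) : ℕ∞) ≤ analyticOrderAt g 1 := by
    rw [natCast_le_analyticOrderAt_iff_iteratedDeriv_eq_zero hg]
    intro i hi
    interval_cases i
    · simpa using h0
    · simpa using h1
    · exact h2
  obtain ⟨u, hu, hgu⟩ := (natCast_le_analyticOrderAt hg).1 h
  have h3 : (fun x => (x - 1) ^ 3 • u x) =O[𝓝 1] fun x => (x - 1) ^ 3 * (1 : ℂ) :=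
    (Asymptotics.isBigO_refl _ _).mul (hu.continuousAt.isBigO_one ℂ)
  simpa using h3.congr' (hgu.mono fun x hx => hx.symm) EventuallyEq.rfl

/-- The Dirichlet series of the Taylor coefficients of `f` continues to `Re s > -3`, and its value
at `-2` is the regularized value `(x d/dx) ^ 2 f (1)` of `∑ a_n n ^ 2`. -/
theorem exists_dirichletSeries_continuation {f : ℂ → ℂ} {A : ℕ → ℂ} (hA : PolyBounded A)
    (hf : DifferentiableOn ℂ f (Metric.ball 0 1)) (hf1 : AnalyticAt ℂ f 1)
    (hAf : ∀ x : ℂ, ‖x‖ < 1 → HasSum (fun n => A n * x ^ n) (f x)) :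
    ∃ D : ℂ → ℂ, DifferentiableOn ℂ D {s : ℂ | -3 < s.re} ∧
      D (-2) = deriv f 1 + iteratedDeriv 2 f 1 ∧
      ∃ σ₁ : ℝ, ∀ s : ℂ, σ₁ < s.re → HasSum (fun n : ℕ => A n * (n : ℂ) ^ (-s)) (D s) := by
  -- the cubic `α x + β x ^ 2 + γ x ^ 3` agreeing with `f` to second order at `1`
  obtain ⟨α, β, γ, e0, e1, e2⟩ : ∃ α β γ : ℂ, α + β + γ = f 1 ∧
      α + 2 * β + 3 * γ = deriv f 1 ∧ 2 * β + 6 * γ = iteratedDeriv 2 f 1 := by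
    set γ := iteratedDeriv 2 f 1 / 2 - deriv f 1 + f 1 with hγ
    refine ⟨f 1 - (deriv f 1 - f 1 - 2 * γ) - γ, deriv f 1 - f 1 - 2 * γ, γ, ?_, ?_, ?_⟩ <;>
      rw [hγ] <;> ring
  set q : ℂ → ℂ := fun x => α * x ^ 1 + β * x ^ 2 + γ * x ^ 3 with hq
  have hqd : ∀ x, HasDerivAt q (α + 2 * β * x + 3 * γ * x ^ 2) x := fun x => by
    have := (((hasDerivAt_pow 1 x).const_mul α).add ((hasDerivAt_pow 2 x).const_mul β)).add
      ((hasDerivAt_pow 3 x).const_mul γ)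
    convert! this using 1
    push_cast
    ring
  have hqd2 : HasDerivAt (fun x : ℂ => α + 2 * β * x + 3 * γ * x ^ 2) (2 * β + 6 * γ) 1 := by
    have := (((hasDerivAt_id (1 : ℂ)).const_mul (2 * β)).const_add α).add
      ((hasDerivAt_pow 2 (1 : ℂ)).const_mul (3 * γ))
    convert! this using 1
    push_cast
    ring
  have hqdf : Differentiable ℂ q := fun x => (hqd x).differentiableAt
  have hqderiv : deriv q = fun x => α + 2 * β * x + 3 * γ * x ^ 2 :=
    funext fun x => (hqd x).deriv
  have hgd : deriv (fun x => f x - q x) =ᶠ[𝓝 1] fun x => deriv f x - deriv q x := by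
    filter_upwards [hf1.eventually_analyticAt] with x hx
    exact deriv_fun_sub hx.differentiableAt (hqdf x)
  have hg1 : (fun x => f x - q x) =O[𝓝 1] fun x => (x - 1) ^ 3 := by
    refine isBigO_sub_one_pow_three (hf1.sub (hqdf.analyticAt 1)) ?_ ?_ ?_
    · rw [← e0, hq]; ring
    · rw [hgd.eq_of_nhds, hqderiv, ← e1]; ring
    · have hq2 : deriv (deriv q) 1 = 2 * β + 6 * γ := by rw [hqderiv, hqd2.deriv]
      rw [iteratedDeriv_succ, iteratedDeriv_one, hgd.deriv_eq,
        deriv_fun_sub hf1.deriv.differentiableAt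
          (by rw [hqderiv]; exact hqd2.differentiableAt), hq2, e2,
        iteratedDeriv_succ, iteratedDeriv_one, sub_self]
  set B : ℕ → ℂ := fun n => A n - (Pi.single 1 α : ℕ → ℂ) n - (Pi.single 2 β : ℕ → ℂ) n
    - (Pi.single 3 γ : ℕ → ℂ) n with hB
  have hBp : PolyBounded B := ((hA.sub (polyBounded_single one_ne_zero α)).sub
    (polyBounded_single two_ne_zero β)).sub (polyBounded_single three_ne_zero γ)
  have hsingle : ∀ (m : ℕ) (c : ℂ) (w : ℕ → ℂ),
      HasSum (fun n => (Pi.single m c : ℕ → ℂ) n * w n) (c * w m) := fun m c w => by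
    have h := hasSum_single (f := fun n => (Pi.single m c : ℕ → ℂ) n * w n) m
      (fun n hn => by rw [Pi.single_eq_of_ne hn, zero_mul])
    simpa using h
  have hBg : ∀ x : ℂ, ‖x‖ < 1 → HasSum (fun n => B n * x ^ n) (f x - q x) := fun x hx => by
    have h := (((hAf x hx).sub (hsingle 1 α (x ^ ·))).sub (hsingle 2 β (x ^ ·))).sub
      (hsingle 3 γ (x ^ ·))
    have hfq : f x - q x = f x - α * x ^ 1 - β * x ^ 2 - γ * x ^ 3 := by rw [hq]; ring
    rw [hfq]
    refine h.congr_fun fun n => ?_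
    rw [hB]; ring
  obtain ⟨hM, σ₁, hsum⟩ := mellin_continuation hBp (hf.sub hqdf.differentiableOn) hBg hg1
  refine ⟨fun s => mellin (fun t : ℝ => f (Real.exp (-t) : ℝ) - q (Real.exp (-t) : ℝ)) s *
      (Complex.Gamma s)⁻¹ + (α + β * (2 : ℂ) ^ (-s) + γ * (3 : ℂ) ^ (-s)), ?_, ?_, σ₁,
      fun s hs => ?_⟩
  · refine DifferentiableOn.add (by simpa using hM) (Differentiable.differentiableOn ?_)
    have hpow : ∀ c : ℂ, c ≠ 0 → Differentiable ℂ fun s : ℂ => c ^ (-s) := fun c hc s =>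
      ((hasDerivAt_neg s).const_cpow (Or.inl hc)).differentiableAt
    exact ((differentiable_const α).add ((hpow 2 two_ne_zero).const_mul β)).add
      ((hpow 3 three_ne_zero).const_mul γ)
  -- the Mellin part vanishes at `-2`: `1 / Γ` has a zero there, which the conventions
  -- `Γ(-2) = 0` and `0⁻¹ = 0` represent correctly
  · have hΓ : Complex.Gamma (-2) = 0 := by simpa using Complex.Gamma_neg_nat_eq_zero 2
    have h2 : (2 : ℂ) ^ (-(-2) : ℂ) = 4 := by rw [neg_neg]; norm_num
    have h3 : (3 : ℂ) ^ (-(-2) : ℂ) = 9 := by rw [neg_neg]; norm_num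
    simp only [hΓ, h2, h3, inv_zero, mul_zero, zero_add]
    rw [← e1, ← e2]
    ring
  · have h := (((hsum s hs).add (hsingle 1 α fun n => (n : ℂ) ^ (-s))).add
      (hsingle 2 β fun n => (n : ℂ) ^ (-s))).add (hsingle 3 γ fun n => (n : ℂ) ^ (-s))
    simp only [Nat.cast_one, Complex.one_cpow, mul_one, Nat.cast_ofNat] at h
    rw [add_assoc, add_assoc, ← add_assoc α] at h
    refine h.congr_fun fun n => ?_
    rw [hB]; ring

/-! ### Values of `ζ` at `0` and `-1` -/

theorem riemannZeta_neg_one : riemannZeta (-1) = -1 / 12 := by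
  have h := riemannZeta_neg_nat_eq_bernoulli 1
  rw [Nat.cast_one, one_add_one_eq_two, bernoulli_two] at h
  rw [h]
  norm_num

theorem logZetaSecond_zero : logZetaSecond 0 =
    -(2 * iteratedDeriv 2 riemannZeta 0 + (Real.log (2 * Real.pi) : ℂ) ^ 2) := by
  have hlog : Complex.log (2 * Real.pi) = (Real.log (2 * Real.pi) : ℂ) := by
    rw [Complex.ofReal_log (by positivity)]
    push_cast
    rfl
  rw [logZetaSecond, riemannZeta_zero, deriv_riemannZeta_zero, hlog]
  ring

theorem meromorphic_riemannZeta : Meromorphic riemannZeta := by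
  intro s
  rcases eq_or_ne s 1 with rfl | hs
  · have h : MeromorphicAt (fun z => (z - 1)⁻¹ * riemannZeta₁ z) 1 :=
      ((MeromorphicAt.id 1).sub (MeromorphicAt.const 1 1)).inv.mul
        (differentiable_riemannZeta₁.analyticAt 1).meromorphicAt
    refine h.congr ?_
    filter_upwards [self_mem_nhdsWithin] with z hz using (riemannZeta_eq_inv_sub_mul hz).symm
  · refine AnalyticAt.meromorphicAt (DifferentiableOn.analyticAt (s := {1}ᶜ) (fun z hz => ?_)
      (isOpen_compl_singleton.mem_nhds hs))
    exact (differentiableAt_riemannZeta hz).differentiableWithinAt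

/-! ### The Dirichlet series of the coefficients `c_n` and the regularized value -/

/-- The Dirichlet series of `c_n` is the product of those of `a_n n` and of the Möbius function. -/
theorem hasSum_coeff {f : ℂ → ℂ} {h d : ℂ} (hh : 1 < h.re)
    (hd : HasSum (fun n : ℕ => taylorCoeff f n * (n : ℂ) ^ (-(h - 1))) d) :
    HasSum (fun n : ℕ => coeff f n * (n : ℂ) ^ (-h)) (d * (riemannZeta h)⁻¹) := by
  have hterm : ∀ (a : ℕ → ℂ) (n : ℕ), a 0 = 0 →
      LSeries.term a h n = a n * (n : ℂ) ^ (-h) := by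
    intro a n ha
    rcases eq_or_ne n 0 with rfl | hn
    · simp [ha]
    · rw [LSeries.term_of_ne_zero hn, Complex.cpow_neg, div_eq_mul_inv]
  have h1 : LSeriesHasSum (fun n => taylorCoeff f n * n) h d := by
    refine hd.congr_fun fun n => ?_
    rw [hterm _ n (by simp)]
    rcases eq_or_ne n 0 with rfl | hn
    · have : -(h - 1) ≠ 0 := by
        intro h0
        have := congrArg Complex.re h0
        simp at this
        linarith
      rw [Nat.cast_zero, Complex.zero_cpow this]
      simp
    · have hn' : (n : ℂ) ≠ 0 := by exact_mod_cast hn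
      rw [show -(h - 1) = -h + 1 by ring, Complex.cpow_add _ _ hn', Complex.cpow_one]
      ring
  have h2 : LSeriesHasSum (fun n => ((ArithmeticFunction.moebius n : ℤ) : ℂ)) h
      (riemannZeta h)⁻¹ := by
    have hs := (ArithmeticFunction.LSeriesSummable_moebius_iff.2 hh).LSeriesHasSum
    have hm := LSeries_one_mul_Lseries_moebius hh
    rw [LSeries_one_eq_riemannZeta hh] at hm
    rwa [eq_inv_of_mul_eq_one_right hm] at hs
  have h3 := h1.convolution h2
  refine HasSum.congr_fun h3 fun n => ?_
  rw [hterm _ n (LSeries.convolution_map_zero _ _), LSeries.convolution_def, coeff_eq]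

/-- The continuation in `h` of the series at `s = 0`, with its limit at `h = -1`. -/
theorem exists_regularization {f : ℂ → ℂ} (hf : DifferentiableOn ℂ f (Metric.ball 0 1))
    (hf1 : AnalyticAt ℂ f 1) (hA : PolyBounded (taylorCoeff f)) :
    ∃ (Φ : ℂ → ℂ) (σ₁ : ℝ), MeromorphicOn Φ {h : ℂ | -2 < h.re} ∧
      (∀ h : ℂ, σ₁ < h.re → HasSum (zetaTerm f h 0) (Φ h)) ∧
      Tendsto Φ (𝓝[≠] (-1)) (𝓝 ((deriv f 1 + iteratedDeriv 2 f 1) *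
        (24 * iteratedDeriv 2 riemannZeta 0 + 12 * (Real.log (2 * Real.pi) : ℂ) ^ 2))) := by
  obtain ⟨D, hD, hD2, σ₁, hsum⟩ := exists_dirichletSeries_continuation hA hf hf1
    (fun x hx => hasSum_taylorCoeff hf hx)
  have hU : IsOpen {s : ℂ | -3 < s.re} := isOpen_lt continuous_const Complex.continuous_re
  have hDana : ∀ h : ℂ, -2 < h.re → AnalyticAt ℂ (fun h => D (h - 1)) h := by
    intro h hh
    have hmem : h - 1 ∈ {s : ℂ | -3 < s.re} := by
      simp only [Set.mem_ofPred_eq, Complex.sub_re, Complex.one_re]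
      linarith
    have hsub : AnalyticAt ℂ (fun h : ℂ => h - 1) h := by fun_prop
    exact AnalyticAt.fun_comp (g := D) (f := fun h => h - 1) (hD.analyticAt (hU.mem_nhds hmem)) hsub
  refine ⟨fun h => D (h - 1) * (riemannZeta h)⁻¹ * logZetaSecond 0, max 1 (σ₁ + 1),
    fun h hh => ?_, fun h hh => ?_, ?_⟩
  · exact ((hDana h hh).meromorphicAt.mul (meromorphic_riemannZeta h).inv).mul
      (MeromorphicAt.const _ _)
  · obtain ⟨h1, h2⟩ := max_lt_iff.1 hh
    have h3 := (hasSum_coeff h1 (hsum (h - 1) (by simp; linarith))).mul_right (logZetaSecond 0)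
    exact h3.congr_fun fun n => by rw [zetaTerm, mul_zero]
  · have hζ : ContinuousAt riemannZeta (-1) :=
      (differentiableAt_riemannZeta (by norm_num)).continuousAt
    have hc : ContinuousAt (fun h => D (h - 1) * (riemannZeta h)⁻¹ * logZetaSecond 0) (-1) :=
      ((hDana (-1) (by simp)).continuousAt.mul
        (hζ.inv₀ (by rw [riemannZeta_neg_one]; norm_num))).mul continuousAt_const
    have ht := hc.tendsto.mono_left (nhdsWithin_le_nhds (s := {-1}ᶜ))
    convert ht using 2
    rw [show (-1 - 1 : ℂ) = -2 by norm_num, hD2, riemannZeta_neg_one, logZetaSecond_zero]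
    ring

theorem isPreconnected_re_gt (σ : ℝ) : IsPreconnected {z : ℂ | σ < z.re} :=
  (convex_halfSpace_re_gt σ).isPreconnected

/-- Meromorphic functions on half-planes that agree far to the right agree near every point of
both half-planes, up to that point itself. -/
theorem eventuallyEq_nhdsNE_of_eq_right {Φ Ψ : ℂ → ℂ} {σ σ' τ : ℝ}
    (hΦ : MeromorphicOn Φ {z : ℂ | σ < z.re}) (hΨ : MeromorphicOn Ψ {z : ℂ | σ' < z.re})
    (heq : ∀ z : ℂ, τ < z.re → Φ z = Ψ z) {z : ℂ} (hz : σ < z.re) (hz' : σ' < z.re) :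
    Φ =ᶠ[𝓝[≠] z] Ψ := by
  have hmero : MeromorphicOn (Φ - Ψ) {z : ℂ | max σ σ' < z.re} := fun w hw =>
    have hw' := max_lt_iff.1 (show max σ σ' < w.re from hw)
    (hΦ w hw'.1).sub (hΨ w hw'.2)
  -- a point of both half-planes to the right of `τ`
  set w : ℂ := ((max (max σ σ') τ + 1 : ℝ) : ℂ) with hw
  have hwre : w.re = max (max σ σ') τ + 1 := by rw [hw, Complex.ofReal_re]
  have hw1 : max σ σ' < w.re := by
    rw [hwre]; linarith [le_max_left (max σ σ') τ]
  have hw2 : τ < w.re := by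
    rw [hwre]; linarith [le_max_right (max σ σ') τ]
  have htop : meromorphicOrderAt (Φ - Ψ) w = ⊤ := by
    rw [meromorphicOrderAt_eq_top_iff]
    have hU : IsOpen {z : ℂ | τ < z.re} := isOpen_lt continuous_const Complex.continuous_re
    filter_upwards [nhdsWithin_le_nhds (hU.mem_nhds hw2)] with v hv
    rw [Pi.sub_apply, heq v hv, sub_self]
  have hztop : meromorphicOrderAt (Φ - Ψ) z = ⊤ := by
    by_contra hne
    exact hmero.meromorphicOrderAt_ne_top_of_isPreconnected (isPreconnected_re_gt _)
      (max_lt hz hz') hw1 hne htop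
  rw [meromorphicOrderAt_eq_top_iff] at hztop
  filter_upwards [hztop] with v hv using sub_eq_zero.1 hv

/-- The regularized value of `∑_p (log p) ^ 2` exists, is unique and does not depend on `f`. -/
theorem isRegularizedLogSqSum_iff {f : ℂ → ℂ} (hf : DifferentiableOn ℂ f (Metric.ball 0 1))
    (hf1 : AnalyticAt ℂ f 1) (hA : PolyBounded (taylorCoeff f))
    (hne : deriv f 1 + iteratedDeriv 2 f 1 ≠ 0) (V : ℂ) :
    IsRegularizedLogSqSum f V ↔
      V = 24 * iteratedDeriv 2 riemannZeta 0 + 12 * (Real.log (2 * Real.pi) : ℂ) ^ 2 := by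
  obtain ⟨Ψ, τ, hΨ, hΨsum, hΨlim⟩ := exists_regularization hf hf1 hA
  constructor
  · intro hV
    obtain ⟨Φ, σ₀, σ₁, hσ₀, hΦ, hΦsum, hΦlim⟩ := hV.value
    have heq : Φ =ᶠ[𝓝[≠] (-1)] Ψ := eventuallyEq_nhdsNE_of_eq_right (τ := max σ₁ τ) hΦ hΨ
      (fun z hz => (hΦsum z (max_lt_iff.1 hz).1).unique (hΨsum z (max_lt_iff.1 hz).2))
      (by simpa using hσ₀) (by simp)
    exact mul_left_cancel₀ hne (tendsto_nhds_unique (hΦlim.congr' heq) hΨlim)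
  · rintro rfl
    exact ⟨fun s hs => primeSum_expansion hf hA hs,
      Ψ, -2, τ, by norm_num, hΨ, hΨsum, hΨlim⟩

end PrimeProduct

theorem proposition4 (f : ℂ → ℂ)
    (hf : DifferentiableOn ℂ f (Metric.ball 0 1)) (hf1 : AnalyticAt ℂ f 1) (hf0 : f 0 = 0)
    (hgrowth : ∃ k : ℕ, (fun n : ℕ => iteratedDeriv n f 0 / (Nat.factorial n : ℂ))
      =O[Filter.atTop] (fun n : ℕ => (n : ℝ) ^ k))
    (hne : deriv f 1 + iteratedDeriv 2 f 1 ≠ 0) (W : ℂ) :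
    PrimeProduct.IsRegularizedProduct f W ↔
      W = Complex.exp (24 * iteratedDeriv 2 riemannZeta 0
        + 12 * (Real.log (2 * Real.pi) : ℂ) ^ 2) := by
  simp only [PrimeProduct.IsRegularizedProduct, PrimeProduct.isRegularizedLogSqSum_iff hf hf1
    (PrimeProduct.polyBounded_taylorCoeff hf0 hgrowth) hne, exists_eq_left]
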